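/- There is a universal constant $C>0$ with the following property. Let $\lambda=(\lambda_n)_{n\ge1}$ be an arbitrary frequency, i.e. a strictly increasing sequence of non-negative real numbers tending to $+\infty$. Let $(G,\beta)$ be any $\lambda$-Dirichlet group: $G$ is a compact (Hausdorff) abelian group with normalized Haar measure, $\beta\colon(\mathbb R,+)\to G$ is a continuous homomorphism with dense range, and for every $n$ there is a (necessarily unique) continuous character $h_{\lambda_n}$ of $G$ with $h_{\lambda_n}(\beta(t))=e^{-i\lambda_n t}$ for all $t\in\mathbb R$. Let $H_\infty^\lambda(G)$ be the space of all $f\in L_\infty(G)$ whose Fourier coefficients $\widehat f(\chi)=\int_G f\,\overline{\chi}$ vanish at all characters $\chi\notin\{h_{\lambda_n}:n\ge1\}$, and let $\mathcal H_\infty(\lambda)$ be the space of all formal Dirichlet series $D=\sum a_n(D)e^{-\lambda_ns}$ for which there is a (necessarily unique) $f\in H^\lambda_\infty(G)$ with $a_n(D)=\widehat f(h_{\lambda_n})$ for all $n$, normed by $\|D\|_\infty:=\|f\|_{L_\infty(G)}$. Then for all $D\in\mathcal H_\infty(\lambda)$, all $0<k\le1$ and all $N\ge1$, the partial sum $\sum_{n=1}^N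 a_n(D)e^{-\lambda_ns}$ belongs to $\mathcal H_\infty(\lambda)$ and $$\Big\|\sum_{n=1}^{N}a_n(D)e^{-\lambda_ns}\Big\|_\infty\le\frac Ck\Big(\frac{\lambda_{N+1}}{\lambda_{N+1}-\lambda_N}\Big)^k\|D\|_\infty ,$$ where the left-hand norm may be read both as the norm of $\mathcal H_\infty(\lambda)$ and as $\sup_{\operatorname{Re}s>0}\big|\sum_{n=1}^{N}a_n(D)e^{-\lambda_ns}\big|$. -/

import Mathlib

open MeasureTheory Filter Topology
open scoped ENNReal ComplexConjugate

noncomputable section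

/-- A frequency: a strictly increasing sequence of non-negative reals tending to `+∞`
(indexed from `0`, so `lam n` is the `(n+1)`-st term). -/
structure IsFrequency (lam : ℕ → ℝ) : Prop where
  strictMono : StrictMono lam
  nonneg : ∀ n, 0 ≤ lam n
  tendsto : Tendsto lam atTop atTop

/-- The normalized Haar measure of a compact group: the regular Haar measure giving mass `1` to
the whole group. -/
def normalizedHaar (G : Type*) [Group G] [TopologicalSpace G] [IsTopologicalGroup G]
    [CompactSpace G] [MeasurableSpace G] [BorelSpace G] : Measure G :=
  Measure.haarMeasure (⊤ : TopologicalSpace.PositiveCompacts G)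

section DirichletGroup

variable {G : Type*} [CommGroup G] [TopologicalSpace G]

/-- The character `χ` of `G` satisfies `χ ∘ β = e^{-ix·}`. If `β` has dense range there is at most
one such `χ` for each real `x`; it is the character `h_x`. -/
def HasFrequency (β : Multiplicative ℝ →ₜ* G) (χ : PontryaginDual G) (x : ℝ) : Prop :=
  ∀ t : ℝ, (χ (β (Multiplicative.ofAdd t)) : ℂ) = Complex.exp (-(Complex.I * x * t))

/-- `(G, β)` is a `lam`-Dirichlet group: the continuous homomorphism `β : (ℝ, +) → G` has dense
range, and every `e^{-i lam n ·}` has the form `h ∘ β` for a character `h` of `G`. -/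
structure IsLambdaDirichletGroup (lam : ℕ → ℝ) (β : Multiplicative ℝ →ₜ* G) : Prop where
  denseRange : DenseRange β
  exists_character : ∀ n, ∃ χ : PontryaginDual G, HasFrequency β χ (lam n)

variable [IsTopologicalGroup G] [CompactSpace G] [MeasurableSpace G] [BorelSpace G]

/-- The Fourier coefficient of `f` at the character `χ`. -/
def groupFourierCoeff (f : G → ℂ) (χ : PontryaginDual G) : ℂ :=
  ∫ ω, f ω * conj (χ ω : ℂ) ∂(normalizedHaar G)

/-- The Hardy space `H_p^lam(G)`: all `f ∈ L_p(G)` whose Fourier transform vanishes off the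
characters `h_{lam n}`. -/
def groupHardySpace (lam : ℕ → ℝ) (β : Multiplicative ℝ →ₜ* G) (p : ℝ≥0∞) :
    Set (Lp ℂ p (normalizedHaar G)) :=
  {f | ∀ χ : PontryaginDual G, (∀ n, ¬ HasFrequency β χ (lam n)) → groupFourierCoeff f χ = 0}

/-- The Dirichlet series `∑ a n e^{-lam n s}` is the Bohr transform of `f`, that is, `a n` is the
Fourier coefficient of `f` at `h_{lam n}` for all `n`. -/
def IsBohrTransform (lam : ℕ → ℝ) (β : Multiplicative ℝ →ₜ* G) (f : G → ℂ) (a : ℕ → ℂ) : Prop :=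
  ∀ n, ∃ χ : PontryaginDual G, HasFrequency β χ (lam n) ∧ a n = groupFourierCoeff f χ

/-- The Hardy space `𝓗_p(lam)` of Dirichlet series. A formal `lam`-Dirichlet series
`∑ a n e^{-lam n s}` is given by its coefficient sequence `a`. -/
def dirichletHardySpace (lam : ℕ → ℝ) (β : Multiplicative ℝ →ₜ* G) (p : ℝ≥0∞) : Set (ℕ → ℂ) :=
  {a | ∃ f ∈ groupHardySpace lam β p, IsBohrTransform lam β f a}

/-- The norm on `𝓗_p(lam)`: the `L_p`-norm of the function `f ∈ H_p^lam(G)` with Bohr transform `a`.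
As this `f` is unique (for `1 ≤ p`), the set below has exactly one element for every `a` in
`𝓗_p(lam)`. -/
def dirichletHardyNorm (lam : ℕ → ℝ) (β : Multiplicative ℝ →ₜ* G) (p : ℝ≥0∞) (a : ℕ → ℂ) : ℝ :=
  sInf {r : ℝ | ∃ f ∈ groupHardySpace lam β p, IsBohrTransform lam β f a ∧ r = ‖f‖}

end DirichletGroup

/-- The coefficients of the partial sum of a Dirichlet series up to and including the index `N`. -/
def dirichletPartialSum (a : ℕ → ℂ) (N : ℕ) : ℕ → ℂ :=
  fun n => if n ≤ N then a n else 0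

end

/-! The partial sum is a smooth truncation of `f`. Put `a = lam N`, `b = lam (N + 1)`. The trapezoid
is `1` on `[-a, a]` and `0` off `(-b, b)`, and no frequency lies strictly between `a` and `b`, so
using it as a Fourier multiplier cuts `f` exactly after the index `N`. Its Fourier transform `κ`
satisfies `‖κ‖₁ ≤ 6 + 2 log (b / (b - a))`, and `k log r + 1 ≤ r ^ k` turns the logarithm into `8 /
k * r ^ k` (`exists_kernel`).

The multiplier acts by averaging translates along `β` with density `κ`. It is applied to continuous
test functions rather than to the class `f`: with `p` the partial sum on `G`, duality gives `∫ p *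
conj q = ∫ f * conj (kernelAverage β κ q)` for every trigonometric polynomial `q`
(`integral_mul_conj_kernelAverage`). Taking `q = p * |p| ^ (2 * m)` gives `∫ |p| ^ (2m+2) ≤ ‖κ‖₁ ‖f‖
∫ |p| ^ (2m+1)` for all `m`, and large `m` forces `|p| ≤ ‖κ‖₁ ‖f‖` everywhere
(`norm_le_of_integral_norm_pow_le`). Restricting `p` to the range of `β` bounds the Dirichlet
polynomial on the imaginary axis, and Phragmén–Lindelöf carries the bound to the half-plane. -/

/-! ### The trapezoid and pointwise bounds for its Fourier transform -/

/-- The trapezoid function: `1` on `[-a, a]`, `0` off `[-b, b]`, and linear in between. -/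
noncomputable def trapezoid (a b x : ℝ) : ℂ :=
  (((max (b - |x|) 0 - max (a - |x|) 0) / (b - a) : ℝ) : ℂ)

theorem trapezoid_eq_one {a b x : ℝ} (hab : a < b) (hx : |x| ≤ a) : trapezoid a b x = 1 := by
  rw [trapezoid, max_eq_left (by linarith), max_eq_left (by linarith),
    show b - |x| - (a - |x|) = b - a by ring, div_self (by linarith), Complex.ofReal_one]

theorem trapezoid_eq_zero {a b x : ℝ} (hab : a < b) (hx : b ≤ |x|) : trapezoid a b x = 0 := by
  rw [trapezoid, max_eq_right (by linarith), max_eq_right (by linarith)]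
  simp

theorem continuous_trapezoid (a b : ℝ) : Continuous (trapezoid a b) := by
  unfold trapezoid
  fun_prop

theorem norm_trapezoid_le_one {a b : ℝ} (hab : a < b) (x : ℝ) : ‖trapezoid a b x‖ ≤ 1 := by
  have h0 : 0 < b - a := by linarith
  rw [trapezoid, Complex.norm_real, Real.norm_eq_abs, abs_le, le_div_iff₀ h0, div_le_iff₀ h0]
  constructor <;>
  rcases max_cases (b - |x|) 0 with h1 | h1 <;> rcases max_cases (a - |x|) 0 with h2 | h2 <;>
    linarith

theorem hasCompactSupport_trapezoid {a b : ℝ} (hab : a < b) :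
    HasCompactSupport (trapezoid a b) := by
  refine HasCompactSupport.intro (isCompact_Icc (a := -b) (b := b)) fun x hx => ?_
  refine trapezoid_eq_zero hab ?_
  by_contra! h
  exact hx (abs_le.mp h.le)

theorem integrable_trapezoid {a b : ℝ} (hab : a < b) : Integrable (trapezoid a b) :=
  (continuous_trapezoid a b).integrable_of_hasCompactSupport (hasCompactSupport_trapezoid hab)

theorem integrable_tent (b : ℝ) : Integrable fun x : ℝ => ((max (b - |x|) 0 : ℝ) : ℂ) := by
  refine Continuous.integrable_of_hasCompactSupport (by fun_prop)
    (HasCompactSupport.intro (isCompact_Icc (a := -b) (b := b)) fun x hx => ?_)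
  rw [max_eq_right, Complex.ofReal_zero]
  by_contra! h
  exact hx (abs_le.mp (by linarith))

/-- The trapezoid is a difference of two tents divided by `b - a`, so this integral determines its
transform. Each half of the tent has an explicit antiderivative. -/
theorem integral_exp_mul_tent {b : ℝ} (hb : 0 ≤ b) {c : ℂ} (hc : c ≠ 0) :
    ∫ x : ℝ, Complex.exp (c * x) * ((max (b - |x|) 0 : ℝ) : ℂ) =
      (Complex.exp (c * b) + Complex.exp (-(c * b)) - 2) / c ^ 2 := by
  have hsupp : ∫ x : ℝ, Complex.exp (c * x) * ((max (b - |x|) 0 : ℝ) : ℂ) =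
      ∫ x in (-b)..b, Complex.exp (c * x) * ((max (b - |x|) 0 : ℝ) : ℂ) := by
    refine (intervalIntegral.integral_eq_integral_of_support_subset fun x hx => ?_).symm
    by_contra h
    apply hx
    have : b ≤ |x| := by
      by_contra! h'
      exact h ⟨(abs_lt.mp h').1, (abs_lt.mp h').2.le⟩
    simp [max_eq_right (show b - |x| ≤ 0 by linarith)]
  have hcont : Continuous fun x : ℝ => Complex.exp (c * x) * ((max (b - |x|) 0 : ℝ) : ℂ) := by
    fun_prop
  have hexp (x : ℝ) : HasDerivAt (fun x : ℝ => Complex.exp (c * x)) (Complex.exp (c * x) * c) x := by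
    have := ((hasDerivAt_id x).ofReal_comp.const_mul c).cexp
    simpa using this
  have hpos : ∫ x in (0 : ℝ)..b, Complex.exp (c * x) * ((max (b - |x|) 0 : ℝ) : ℂ) =
      Complex.exp (c * b) / c ^ 2 - b / c - 1 / c ^ 2 := by
    have hd (x : ℝ) : HasDerivAt (fun x : ℝ => ((b - x) / c + 1 / c ^ 2) * Complex.exp (c * x))
        (Complex.exp (c * x) * (b - x)) x := by
      have h1 : HasDerivAt (fun x : ℝ => ((b - x) / c + 1 / c ^ 2 : ℂ)) ((-1) / c) x := by
        simpa using ((((hasDerivAt_id x).ofReal_comp.const_sub (b : ℂ)).div_const c).add_const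
          (1 / c ^ 2))
      refine (h1.mul (hexp x)).congr_deriv ?_
      field_simp
      ring
    rw [intervalIntegral.integral_congr (g := fun x : ℝ => Complex.exp (c * x) * (b - x)),
      intervalIntegral.integral_eq_sub_of_hasDerivAt (fun x _ => hd x)
        (Continuous.intervalIntegrable (by fun_prop) _ _)]
    · simp
      ring
    · intro x hx
      rw [Set.uIcc_of_le hb] at hx
      simp only [abs_of_nonneg hx.1, max_eq_left (sub_nonneg.mpr hx.2)]
      push_cast
      rfl
  have hneg : ∫ x in (-b)..0, Complex.exp (c * x) * ((max (b - |x|) 0 : ℝ) : ℂ) =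
      Complex.exp (-(c * b)) / c ^ 2 + b / c - 1 / c ^ 2 := by
    have hd (x : ℝ) : HasDerivAt (fun x : ℝ => ((b + x) / c - 1 / c ^ 2) * Complex.exp (c * x))
        (Complex.exp (c * x) * (b + x)) x := by
      have h1 : HasDerivAt (fun x : ℝ => ((b + x) / c - 1 / c ^ 2 : ℂ)) (1 / c) x := by
        simpa using ((((hasDerivAt_id x).ofReal_comp.const_add (b : ℂ)).div_const c).sub_const
          (1 / c ^ 2))
      refine (h1.mul (hexp x)).congr_deriv ?_
      field_simp
      ring
    rw [intervalIntegral.integral_congr (g := fun x : ℝ => Complex.exp (c * x) * (b + x)),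
      intervalIntegral.integral_eq_sub_of_hasDerivAt (fun x _ => hd x)
        (Continuous.intervalIntegrable (by fun_prop) _ _)]
    · simp
      ring
    · intro x hx
      rw [Set.uIcc_of_le (by linarith)] at hx
      simp only [abs_of_nonpos hx.2, max_eq_left (show 0 ≤ b - -x by linarith [hx.1])]
      push_cast
      ring
  rw [hsupp, ← intervalIntegral.integral_add_adjacent_intervals
    (hcont.intervalIntegrable (-b) 0) (hcont.intervalIntegrable 0 b), hpos, hneg]
  field_simp
  ring

open FourierTransform in
theorem fourier_trapezoid {a b : ℝ} (ha : 0 ≤ a) (hab : a < b) {w : ℝ} (hw : w ≠ 0) :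
    𝓕 (trapezoid a b) w =
      (Complex.exp (-(2 * Real.pi * w * b : ℝ) * Complex.I)
        - Complex.exp (-(2 * Real.pi * w * a : ℝ) * Complex.I)
        + (Complex.exp ((2 * Real.pi * w * b : ℝ) * Complex.I)
        - Complex.exp ((2 * Real.pi * w * a : ℝ) * Complex.I))) /
        ((-(2 * Real.pi * w : ℝ) * Complex.I) ^ 2 * (b - a)) := by
  set c : ℂ := -(2 * Real.pi * w : ℝ) * Complex.I with hc
  have hc0 : c ≠ 0 := by
    have : (2 * Real.pi * w : ℝ) ≠ 0 := by positivity
    rw [hc]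
    exact mul_ne_zero (neg_ne_zero.mpr (Complex.ofReal_ne_zero.mpr this)) Complex.I_ne_zero
  have hba : (b - a : ℂ) ≠ 0 := by
    rw [← Complex.ofReal_sub, Complex.ofReal_ne_zero]; linarith
  have hint (d : ℝ) :
      Integrable fun x : ℝ => Complex.exp (c * x) * ((max (d - |x|) 0 : ℝ) : ℂ) := by
    refine (integrable_tent d).bdd_mul (c := 1) (Continuous.aestronglyMeasurable (by fun_prop)) ?_
    refine ae_of_all _ fun x => ?_
    rw [show c * x = ((-(2 * Real.pi * w) * x : ℝ) : ℂ) * Complex.I by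
      rw [hc]; push_cast; ring, Complex.norm_exp_ofReal_mul_I]
  rw [Real.fourier_real_eq_integral_exp_smul]
  have : ∀ v : ℝ, Complex.exp (↑(-2 * Real.pi * v * w) * Complex.I) • trapezoid a b v =
      (Complex.exp (c * v) * ((max (b - |v|) 0 : ℝ) : ℂ)
        - Complex.exp (c * v) * ((max (a - |v|) 0 : ℝ) : ℂ)) / (b - a) := by
    intro v
    rw [trapezoid, smul_eq_mul, show (↑(-2 * Real.pi * v * w) * Complex.I : ℂ) = c * v by
      rw [hc]; push_cast; ring]
    push_cast
    ring
  simp_rw [this]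
  rw [integral_div, integral_sub (hint b) (hint a), integral_exp_mul_tent (by linarith) hc0,
    integral_exp_mul_tent ha hc0]
  have e (d : ℝ) : c * d = -(2 * Real.pi * w * d : ℝ) * Complex.I := by
    rw [hc]; push_cast; ring
  have e' (d : ℝ) : -(c * d) = (2 * Real.pi * w * d : ℝ) * Complex.I := by
    rw [hc]; push_cast; ring
  rw [e', e', e, e]
  field_simp
  ring

theorem norm_exp_mul_I_sub_exp_mul_I_le (x y : ℝ) :
    ‖Complex.exp (x * Complex.I) - Complex.exp (y * Complex.I)‖ ≤ |x - y| := by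
  have : Complex.exp (x * Complex.I) - Complex.exp (y * Complex.I) =
      Complex.exp (y * Complex.I) * (Complex.exp (Complex.I * (x - y : ℝ)) - 1) := by
    rw [mul_sub, ← Complex.exp_add, mul_one]
    push_cast
    ring_nf
  rw [this, norm_mul, Complex.norm_exp_ofReal_mul_I, one_mul]
  exact Real.norm_exp_I_mul_ofReal_sub_one_le

-- For the first bound, the exponentials at `b` and `a` are paired and each difference is at most
-- `2π|w|(b - a)`, which cancels `b - a`. For the second, all four are bounded by `1`.
open FourierTransform in
theorem norm_fourier_trapezoid_le {a b : ℝ} (ha : 0 ≤ a) (hab : a < b) {w : ℝ} (hw : w ≠ 0) :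
    ‖𝓕 (trapezoid a b) w‖ ≤ |w|⁻¹ ∧ ‖𝓕 (trapezoid a b) w‖ ≤ (b - a)⁻¹ * (|w| ^ 2)⁻¹ := by
  have hba : 0 < b - a := by linarith
  have hw' : 0 < |w| := abs_pos.mpr hw
  have hpi := Real.pi_gt_three
  rw [fourier_trapezoid ha hab hw, norm_div]
  have hden : ‖(-(2 * Real.pi * w : ℝ) * Complex.I) ^ 2 * ((b : ℂ) - a)‖ =
      (2 * Real.pi * |w|) ^ 2 * (b - a) := by
    rw [← Complex.ofReal_sub, ← Complex.ofReal_neg, norm_mul, norm_pow, norm_mul,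
      Complex.norm_I, Complex.norm_real,
      Complex.norm_real, norm_neg, Real.norm_of_nonneg hba.le, mul_one, norm_mul,
      Real.norm_of_nonneg (by positivity : 0 ≤ 2 * Real.pi), Real.norm_eq_abs]
  have h1 := norm_exp_mul_I_sub_exp_mul_I_le (2 * Real.pi * w * b) (2 * Real.pi * w * a)
  have h2 := norm_exp_mul_I_sub_exp_mul_I_le (-(2 * Real.pi * w * b)) (-(2 * Real.pi * w * a))
  have e1 : |2 * Real.pi * w * b - 2 * Real.pi * w * a| = 2 * Real.pi * |w| * (b - a) := by
    rw [show 2 * Real.pi * w * b - 2 * Real.pi * w * a = 2 * Real.pi * w * (b - a) by ring,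
      abs_mul, abs_mul, abs_of_pos hba, abs_of_nonneg (by positivity : 0 ≤ 2 * Real.pi)]
  have e2 : |-(2 * Real.pi * w * b) - -(2 * Real.pi * w * a)| = 2 * Real.pi * |w| * (b - a) := by
    rw [← e1, ← abs_neg]; ring_nf
  rw [e1] at h1
  rw [e2] at h2
  have h3 := (norm_sub_le (Complex.exp ((2 * Real.pi * w * b : ℝ) * Complex.I))
    (Complex.exp ((2 * Real.pi * w * a : ℝ) * Complex.I)))
  have h4 := (norm_sub_le (Complex.exp ((-(2 * Real.pi * w * b) : ℝ) * Complex.I))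
    (Complex.exp ((-(2 * Real.pi * w * a) : ℝ) * Complex.I)))
  simp only [Complex.norm_exp_ofReal_mul_I] at h3 h4
  rw [hden, ← Complex.ofReal_neg, ← Complex.ofReal_neg]
  constructor
  · rw [div_le_iff₀ (by positivity)]
    refine (norm_add_le _ _).trans ((add_le_add h2 h1).trans ?_)
    rw [show |w|⁻¹ * ((2 * Real.pi * |w|) ^ 2 * (b - a)) =
      2 * Real.pi * |w| * (b - a) * (2 * Real.pi) by field_simp]
    have : 0 ≤ 2 * Real.pi * |w| * (b - a) := by positivity
    nlinarith
  · rw [div_le_iff₀ (by positivity)]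
    refine (norm_add_le _ _).trans ((add_le_add h4 h3).trans ?_)
    rw [show (b - a)⁻¹ * (|w| ^ 2)⁻¹ * ((2 * Real.pi * |w|) ^ 2 * (b - a)) =
      (2 * Real.pi) ^ 2 by field_simp]
    nlinarith

open FourierTransform in
theorem norm_fourier_trapezoid_le_two_mul {a b : ℝ} (ha : 0 ≤ a) (hab : a < b) (w : ℝ) :
    ‖𝓕 (trapezoid a b) w‖ ≤ 2 * b := by
  rw [Real.fourier_real_eq_integral_exp_smul]
  refine (norm_integral_le_integral_norm _).trans ?_
  have h1 (v : ℝ) : ‖Complex.exp (↑(-2 * Real.pi * v * w) * Complex.I) • trapezoid a b v‖ ≤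
      (Set.Icc (-b) b).indicator (fun _ => (1 : ℝ)) v := by
    rw [norm_smul, Complex.norm_exp_ofReal_mul_I, one_mul]
    by_cases hv : v ∈ Set.Icc (-b) b
    · rw [Set.indicator_of_mem hv]
      exact norm_trapezoid_le_one hab v
    · rw [Set.indicator_of_notMem hv, trapezoid_eq_zero hab, norm_zero]
      by_contra! h
      exact hv (abs_le.mp h.le)
  refine (integral_mono_of_nonneg (ae_of_all _ fun _ => norm_nonneg _) ?_
    (ae_of_all _ h1)).trans ?_
  · exact (integrable_indicator_iff measurableSet_Icc).mpr (integrableOn_const (by simp))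
  · rw [integral_indicator measurableSet_Icc]
    simp [max_eq_left (show 0 ≤ b + b by linarith)]
    linarith

/-! ### The `L¹`-norm of the kernel -/

theorem integrable_comp_abs_of_integrableOn_Ioi {g : ℝ → ℝ} (hg : IntegrableOn g (Set.Ioi 0)) :
    Integrable fun x => g |x| := by
  have h1 : IntegrableOn (fun x => g |x|) (Set.Ioi 0) :=
    hg.congr_fun (fun x hx => by rw [abs_of_pos hx]) measurableSet_Ioi
  have h2 : IntegrableOn (fun x => g |x|) (Set.Iic 0) := by
    rw [integrableOn_Iic_iff_integrableOn_Iio]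
    have := IntegrableOn.comp_neg_Iio (c := 0) (f := fun x => g |x|) (by simpa using h1)
    simpa using this
  rw [← integrableOn_univ, ← Set.Iic_union_Ioi (a := (0 : ℝ))]
  exact h2.union h1

/-- The minimum of the three elementary bounds `p⁻¹`, `u⁻¹` and `q * u⁻²`, for `p ≤ q`. -/
noncomputable def kernelMajorant (p q u : ℝ) : ℝ :=
  if u ≤ p then p⁻¹ else if u ≤ q then u⁻¹ else q * (u ^ 2)⁻¹

/-- The outer ranges `(0, p]` and `(q, ∞)` contribute `1` each; the middle range, where the bound is
`u⁻¹`, produces the logarithm. -/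
theorem integral_kernelMajorant {p q : ℝ} (hp : 0 < p) (hpq : p ≤ q) :
    IntegrableOn (kernelMajorant p q) (Set.Ioi 0) ∧
      ∫ u in Set.Ioi 0, kernelMajorant p q u = 2 + Real.log (q / p) := by
  have hq : 0 < q := hp.trans_le hpq
  have e1 : Set.EqOn (fun _ => p⁻¹) (kernelMajorant p q) (Set.Ioc 0 p) := fun u hu => by
    rw [kernelMajorant, if_pos hu.2]
  have e2 : Set.EqOn (fun u => u⁻¹) (kernelMajorant p q) (Set.Ioc p q) := fun u hu => by
    rw [kernelMajorant, if_neg (not_le.mpr hu.1), if_pos hu.2]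
  have e3 : Set.EqOn (fun u => q * u ^ (-2 : ℝ)) (kernelMajorant p q) (Set.Ioi q) := fun u hu => by
    have hu' : q < u := hu
    rw [kernelMajorant, if_neg (not_le.mpr (hpq.trans_lt hu')), if_neg (not_le.mpr hu')]
    simp only [Real.rpow_neg (hq.trans hu').le, Real.rpow_two]
  have i1 : IntegrableOn (kernelMajorant p q) (Set.Ioc 0 p) :=
    (integrableOn_const (by simp)).congr_fun e1 measurableSet_Ioc
  have i2' : IntervalIntegrable (fun u : ℝ => u⁻¹) volume p q := by
    refine ContinuousOn.intervalIntegrable (continuousOn_id.inv₀ fun u hu => ?_)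
    rw [Set.uIcc_of_le hpq] at hu
    exact (hp.trans_le hu.1).ne'
  have i2 : IntegrableOn (kernelMajorant p q) (Set.Ioc p q) :=
    i2'.1.congr_fun e2 measurableSet_Ioc
  have i3 : IntegrableOn (kernelMajorant p q) (Set.Ioi q) :=
    IntegrableOn.congr_fun (Integrable.const_mul
      (integrableOn_Ioi_rpow_of_lt (a := -2) (by norm_num) hq) q) e3 measurableSet_Ioi
  have u1 : Set.Ioc p q ∪ Set.Ioi q = Set.Ioi p := Set.Ioc_union_Ioi_eq_Ioi hpq
  have u2 : Set.Ioc 0 p ∪ Set.Ioi p = Set.Ioi 0 := Set.Ioc_union_Ioi_eq_Ioi hp.le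
  have i4 : IntegrableOn (kernelMajorant p q) (Set.Ioi p) := u1 ▸ i2.union i3
  refine ⟨u2 ▸ i1.union i4, ?_⟩
  rw [← u2, setIntegral_union (Set.Ioc_disjoint_Ioi le_rfl) measurableSet_Ioi i1 i4, ← u1,
    setIntegral_union (Set.Ioc_disjoint_Ioi le_rfl) measurableSet_Ioi i2 i3,
    ← setIntegral_congr_fun measurableSet_Ioc e1, ← setIntegral_congr_fun measurableSet_Ioc e2,
    ← setIntegral_congr_fun measurableSet_Ioi e3, ← intervalIntegral.integral_of_le hpq,
    integral_inv_of_pos hp hq, integral_const_mul, integral_Ioi_rpow_of_lt (by norm_num) hq]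
  have : q ^ (-2 + 1 : ℝ) = q⁻¹ := by
    rw [show (-2 + 1 : ℝ) = -1 by norm_num, Real.rpow_neg_one]
  rw [this]
  simp [hp.le, hp.ne']
  field_simp
  ring

open FourierTransform in
theorem integral_norm_fourier_trapezoid_le {a b : ℝ} (ha : 0 ≤ a) (hab : a < b) :
    Integrable (𝓕 (trapezoid a b)) ∧
      ∫ w, ‖𝓕 (trapezoid a b) w‖ ≤ 6 + 2 * Real.log (b / (b - a)) := by
  have hb : 0 < b := ha.trans_lt hab
  have hba : 0 < b - a := by linarith
  have hp : 0 < (2 * b)⁻¹ := by positivity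
  -- The two halves of the line give `2 * (2 + log (2b / (b - a)))`, and `4 + 2 log 2 ≤ 6`.
  obtain ⟨hi, hv⟩ := integral_kernelMajorant hp
    (show (2 * b)⁻¹ ≤ (b - a)⁻¹ by gcongr; linarith)
  have hi' := integrable_comp_abs_of_integrableOn_Ioi hi
  have hle (w : ℝ) :
      ‖𝓕 (trapezoid a b) w‖ ≤ kernelMajorant (2 * b)⁻¹ (b - a)⁻¹ |w| := by
    rw [kernelMajorant]
    split_ifs with h1 h2
    · rw [inv_inv]
      exact norm_fourier_trapezoid_le_two_mul ha hab w
    · exact (norm_fourier_trapezoid_le ha hab (abs_pos.mp (hp.trans (not_le.mp h1)))).1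
    · exact (norm_fourier_trapezoid_le ha hab (abs_pos.mp (hp.trans (not_le.mp h1)))).2
  have hcont : Continuous (𝓕 (trapezoid a b)) :=
    VectorFourier.fourierIntegral_continuous Real.continuous_fourierChar
      (by exact continuous_inner) (integrable_trapezoid hab)
  refine ⟨hi'.mono' hcont.aestronglyMeasurable (ae_of_all _ hle), ?_⟩
  refine (integral_mono_of_nonneg (ae_of_all _ fun _ => norm_nonneg _) hi'
    (ae_of_all _ hle)).trans ?_
  rw [integral_comp_abs, hv, show (b - a)⁻¹ / (2 * b)⁻¹ = 2 * (b / (b - a)) by field_simp,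
    Real.log_mul two_ne_zero (by positivity)]
  linarith [Real.log_two_lt_d9]

open FourierTransform in
/-- An integrable kernel whose inverse Fourier transform is `1` on `[-a, a]` and `0` off `(-b, b)`,
with `L¹`-norm controlled by `(b / (b - a)) ^ k / k`. -/
theorem exists_kernel {a b : ℝ} (ha : 0 ≤ a) (hab : a < b) :
    ∃ κ : ℝ → ℂ, Integrable κ ∧
      (∀ k : ℝ, 0 < k → k ≤ 1 → ∫ w, ‖κ w‖ ≤ 8 / k * (b / (b - a)) ^ k) ∧
      (∀ x : ℝ, |x| ≤ a →
        ∫ w, κ w * Complex.exp ((2 * Real.pi * w * x : ℝ) * Complex.I) = 1) ∧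
      (∀ x : ℝ, b ≤ |x| →
        ∫ w, κ w * Complex.exp ((2 * Real.pi * w * x : ℝ) * Complex.I) = 0) := by
  obtain ⟨hi, hle⟩ := integral_norm_fourier_trapezoid_le ha hab
  have hinv (x : ℝ) : ∫ w, 𝓕 (trapezoid a b) w *
      Complex.exp ((2 * Real.pi * w * x : ℝ) * Complex.I) = trapezoid a b x := by
    have h := congrFun ((continuous_trapezoid a b).fourierInv_fourier_eq
      (integrable_trapezoid hab) hi) x
    rw [Real.fourierInv_eq'] at h
    rw [← h]
    refine integral_congr_ae (ae_of_all _ fun w => ?_)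
    simp only [smul_eq_mul, RCLike.inner_apply, conj_trivial]
    rw [mul_comm]
    congr 3
    push_cast
    ring
  refine ⟨𝓕 (trapezoid a b), hi, fun k hk hk1 => hle.trans ?_, fun x hx => ?_, fun x hx => ?_⟩
  · have hba : 0 < b - a := by linarith
    set r := b / (b - a) with hr
    have hr1 : 1 ≤ r := by rw [hr, le_div_iff₀ hba]; linarith
    have hr0 : 0 < r := by linarith
    -- Since `k ≤ 1`, `k * (6 + 2 log r) ≤ 6 + 2 k log r ≤ 8 * (1 + k log r)`; this is where the
    -- constant `8` arises.
    have h1 : k * Real.log r + 1 ≤ r ^ k := by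
      rw [Real.rpow_def_of_pos hr0, mul_comm]
      exact Real.add_one_le_exp _
    have hlog : 0 ≤ Real.log r := Real.log_nonneg hr1
    have h2 : 0 ≤ k * Real.log r := by positivity
    rw [div_mul_eq_mul_div, le_div_iff₀ hk]
    nlinarith
  · rw [hinv, trapezoid_eq_one hab hx]
  · rw [hinv, trapezoid_eq_zero hab hx]

/-! ### Characters with a frequency and averages along `β` -/

section

variable {G : Type*} [CommGroup G] [TopologicalSpace G] {β : Multiplicative ℝ →ₜ* G}

theorem HasFrequency.one : HasFrequency β 1 0 := fun t => by simp

theorem HasFrequency.mul {χ ψ : PontryaginDual G} {x y : ℝ} (hχ : HasFrequency β χ x)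
    (hψ : HasFrequency β ψ y) : HasFrequency β (χ * ψ) (x + y) := fun t => by
  have : (χ * ψ) (β (Multiplicative.ofAdd t)) =
    χ (β (Multiplicative.ofAdd t)) * ψ (β (Multiplicative.ofAdd t)) := rfl
  rw [this, Circle.coe_mul, hχ t, hψ t, ← Complex.exp_add]
  push_cast
  ring_nf

theorem HasFrequency.inv {χ : PontryaginDual G} {x : ℝ} (hχ : HasFrequency β χ x) :
    HasFrequency β χ⁻¹ (-x) := fun t => by
  have : χ⁻¹ (β (Multiplicative.ofAdd t)) = (χ (β (Multiplicative.ofAdd t)))⁻¹ := rfl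
  rw [this, Circle.coe_inv, hχ t, ← Complex.exp_neg]
  push_cast
  ring_nf

theorem HasFrequency.eq_of_denseRange (hβ : DenseRange β) {χ ψ : PontryaginDual G} {x : ℝ}
    (hχ : HasFrequency β χ x) (hψ : HasFrequency β ψ x) : χ = ψ := by
  refine DFunLike.coe_injective (hβ.equalizer (map_continuous χ) (map_continuous ψ) ?_)
  funext t
  exact Circle.ext ((hχ t.toAdd).trans (hψ t.toAdd).symm)

theorem HasFrequency.frequency_unique {χ : PontryaginDual G} {x y : ℝ}
    (hx : HasFrequency β χ x) (hy : HasFrequency β χ y) : x = y := by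
  by_contra hne
  have hsub : x - y ≠ 0 := sub_ne_zero.mpr hne
  -- At the time `π / (x - y)` the two exponentials differ by the factor `-1`.
  have h := (hx (Real.pi / (x - y))).symm.trans (hy (Real.pi / (x - y)))
  have h1 : -(Complex.I * x * (Real.pi / (x - y) : ℝ)) =
      -(Complex.I * y * (Real.pi / (x - y) : ℝ)) + -(Real.pi * Complex.I) := by
    have hc : (x - y : ℂ) ≠ 0 := by exact_mod_cast hsub
    push_cast
    field_simp
    ring
  rw [h1, Complex.exp_add, Complex.exp_neg (Real.pi * Complex.I), Complex.exp_pi_mul_I] at h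
  have h2 := Complex.exp_ne_zero (-(Complex.I * y * (Real.pi / (x - y) : ℝ)))
  apply h2
  have h3 : (2 : ℂ) * Complex.exp (-(Complex.I * y * (Real.pi / (x - y) : ℝ))) = 0 := by
    norm_num at h
    push_cast
    linear_combination (-1 : ℂ) * h
  exact (mul_eq_zero.mp h3).resolve_left two_ne_zero

/-- The characters of `G` having a frequency, as a submonoid of the functions on `G`. -/
def frequencyCharacters (β : Multiplicative ℝ →ₜ* G) : Submonoid (G → ℂ) where
  carrier := {g | ∃ (χ : PontryaginDual G) (x : ℝ), HasFrequency β χ x ∧ g = fun ω => (χ ω : ℂ)}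
  one_mem' := ⟨1, 0, HasFrequency.one, by ext; simp⟩
  mul_mem' := by
    rintro _ _ ⟨χ, x, hχ, rfl⟩ ⟨ψ, y, hψ, rfl⟩
    exact ⟨χ * ψ, x + y, hχ.mul hψ, rfl⟩

/-- The trigonometric polynomials built from the characters having a frequency. -/
def trigPolynomials (β : Multiplicative ℝ →ₜ* G) : Subalgebra ℂ (G → ℂ) :=
  Algebra.adjoin ℂ (frequencyCharacters β)

/-- The generating characters are closed under products, so the algebra is their linear span:
products stay inside, while linear identities need checking only on characters. -/
theorem mem_trigPolynomials_iff {g : G → ℂ} :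
    g ∈ trigPolynomials β ↔ g ∈ Submodule.span ℂ (frequencyCharacters β : Set (G → ℂ)) := by
  rw [← Subalgebra.mem_toSubmodule, trigPolynomials, Algebra.adjoin_eq_span,
    Submonoid.closure_eq]

theorem HasFrequency.mem_trigPolynomials {χ : PontryaginDual G} {x : ℝ}
    (hχ : HasFrequency β χ x) : (fun ω => (χ ω : ℂ)) ∈ trigPolynomials β :=
  Algebra.subset_adjoin ⟨χ, x, hχ, rfl⟩

/-- The average of the translates of `q` along `β` with density `κ`. -/
noncomputable def kernelAverage (β : Multiplicative ℝ →ₜ* G) (κ : ℝ → ℂ) (q : G → ℂ) (ω : G) : ℂ :=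
  ∫ w, κ w * q (ω * β (Multiplicative.ofAdd (-(2 * Real.pi * w))))

/-- Averaging is a Fourier multiplier: translation by `β (-2πw)` multiplies `χ` by `e^{2πiwx}`, so
the factor is the inverse Fourier transform of `κ` at the frequency `x`. -/
theorem kernelAverage_character {χ : PontryaginDual G} {x : ℝ} (hχ : HasFrequency β χ x)
    (κ : ℝ → ℂ) (ω : G) :
    kernelAverage β κ (fun ω => (χ ω : ℂ)) ω =
      (∫ w, κ w * Complex.exp ((2 * Real.pi * w * x : ℝ) * Complex.I)) * χ ω := by
  rw [kernelAverage, ← integral_mul_const]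
  congr 1 with w
  rw [map_mul, Circle.coe_mul, hχ]
  push_cast
  ring_nf

theorem continuous_character (χ : PontryaginDual G) : Continuous fun ω => (χ ω : ℂ) :=
  continuous_subtype_val.comp (map_continuous χ)

variable [IsTopologicalGroup G] [CompactSpace G]

theorem integrable_kernel_mul {κ : ℝ → ℂ} (hκ : Integrable κ) {q : G → ℂ} (hq : Continuous q)
    (ω : G) : Integrable fun w => κ w * q (ω * β (Multiplicative.ofAdd (-(2 * Real.pi * w)))) := by
  obtain ⟨c, hc⟩ := isCompact_univ.exists_bound_of_continuousOn hq.continuousOn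
  refine hκ.mul_bdd (c := c) (Continuous.aestronglyMeasurable ?_)
    (ae_of_all _ fun w => hc _ (Set.mem_univ _))
  have : Continuous fun w : ℝ => Multiplicative.ofAdd (-(2 * Real.pi * w)) :=
    continuous_ofAdd.comp (by fun_prop)
  exact hq.comp (continuous_const.mul ((map_continuous β).comp this))

/-! ### Haar integration, duality and the passage from moments to the supremum -/

variable [MeasurableSpace G] [BorelSpace G]

instance : (normalizedHaar G).IsHaarMeasure := by
  unfold normalizedHaar
  infer_instance

instance : IsProbabilityMeasure (normalizedHaar G) :=
  ⟨by simpa [normalizedHaar] using Measure.haarMeasure_self (K₀ := (⊤ : TopologicalSpace.PositiveCompacts G))⟩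

theorem integrable_of_continuous {E : Type*} [NormedAddCommGroup E]
    [SecondCountableTopologyEither G E] {q : G → E} (hq : Continuous q) :
    Integrable q (normalizedHaar G) :=
  hq.integrable_of_hasCompactSupport (HasCompactSupport.of_compactSpace q)

theorem integral_character_eq_zero {χ : PontryaginDual G} (hχ : χ ≠ 1) :
    ∫ ω, (χ ω : ℂ) ∂(normalizedHaar G) = 0 := by
  obtain ⟨g, hg⟩ : ∃ g, χ g ≠ 1 := by
    by_contra! h
    exact hχ (PontryaginDual.ext h)
  have h := integral_mul_left_eq_self (μ := normalizedHaar G) (fun ω => (χ ω : ℂ)) g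
  simp only [map_mul, Circle.coe_mul, integral_const_mul] at h
  have h1 : ((χ g : ℂ) - 1) * ∫ ω, (χ ω : ℂ) ∂(normalizedHaar G) = 0 := by
    rw [sub_mul, h, one_mul, sub_self]
  refine (mul_eq_zero.mp h1).resolve_left (sub_ne_zero.mpr fun h2 => hg (Circle.ext ?_))
  simpa using h2

theorem integral_character_mul_conj {χ ψ : PontryaginDual G} [Decidable (χ = ψ)] :
    ∫ ω, (χ ω : ℂ) * conj (ψ ω : ℂ) ∂(normalizedHaar G) = if χ = ψ then 1 else 0 := by
  split_ifs with h
  · subst h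
    simp [Complex.mul_conj, Circle.normSq_coe]
  · rw [← integral_character_eq_zero (χ := χ * ψ⁻¹) fun h1 => h (mul_inv_eq_one.mp h1)]
    congr 1 with ω
    have : (χ * ψ⁻¹) ω = χ ω * (ψ ω)⁻¹ := rfl
    rw [this, Circle.coe_mul, Circle.coe_inv_eq_conj]

theorem groupFourierCoeff_sum_characters [DecidableEq (PontryaginDual G)] {ι : Type*}
    (s : Finset ι) (a : ι → ℂ) (χ : ι → PontryaginDual G) (ψ : PontryaginDual G) :
    groupFourierCoeff (fun ω => ∑ n ∈ s, a n * (χ n ω : ℂ)) ψ =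
      ∑ n ∈ s, if χ n = ψ then a n else 0 := by
  simp only [groupFourierCoeff, Finset.sum_mul, mul_assoc]
  rw [integral_finsetSum]
  · simp [integral_const_mul, integral_character_mul_conj]
  · intro n _
    exact integrable_of_continuous (continuous_const.mul ((continuous_character _).mul
      (Complex.continuous_conj.comp (continuous_character _))))

/-- Fubini and translation invariance of Haar measure, as in Young's inequality. -/
theorem integral_norm_kernelAverage_le {κ : ℝ → ℂ} (hκ : Integrable κ) {q : G → ℂ}
    (hq : Continuous q) :
    ∫ ω, ‖kernelAverage β κ q ω‖ ∂(normalizedHaar G) ≤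
      (∫ w, ‖κ w‖) * ∫ ω, ‖q ω‖ ∂(normalizedHaar G) := by
  obtain ⟨c, hc⟩ := isCompact_univ.exists_bound_of_continuousOn hq.continuousOn
  have hβc : Continuous fun w : ℝ => β (Multiplicative.ofAdd (-(2 * Real.pi * w))) :=
    (map_continuous β).comp (continuous_ofAdd.comp (by fun_prop))
  have hcont : Continuous fun z : G × ℝ =>
      ‖q (z.1 * β (Multiplicative.ofAdd (-(2 * Real.pi * z.2))))‖ :=
    (hq.comp (continuous_fst.mul (hβc.comp continuous_snd))).norm
  have hint : Integrable (fun z : G × ℝ =>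
      ‖κ z.2‖ * ‖q (z.1 * β (Multiplicative.ofAdd (-(2 * Real.pi * z.2))))‖)
      ((normalizedHaar G).prod volume) := by
    refine (hκ.norm.comp_snd (normalizedHaar G)).mul_bdd (c := c) hcont.aestronglyMeasurable
      (ae_of_all _ fun z => ?_)
    rw [norm_norm]
    exact hc _ (Set.mem_univ _)
  calc ∫ ω, ‖kernelAverage β κ q ω‖ ∂(normalizedHaar G)
      ≤ ∫ ω, (∫ w, ‖κ w‖ * ‖q (ω * β (Multiplicative.ofAdd (-(2 * Real.pi * w))))‖)
          ∂(normalizedHaar G) := by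
        refine integral_mono_of_nonneg (ae_of_all _ fun _ => norm_nonneg _)
          hint.integral_prod_left (ae_of_all _ fun ω => ?_)
        refine (norm_integral_le_integral_norm _).trans_eq ?_
        simp only [norm_mul]
    _ = ∫ w, (∫ ω, ‖κ w‖ * ‖q (ω * β (Multiplicative.ofAdd (-(2 * Real.pi * w))))‖
          ∂(normalizedHaar G)) := integral_integral_swap hint
    _ = (∫ w, ‖κ w‖) * ∫ ω, ‖q ω‖ ∂(normalizedHaar G) := by
        rw [← integral_mul_const]
        congr 1 with w
        rw [integral_const_mul, integral_mul_right_eq_self (fun ω => ‖q ω‖)]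

/-- Both sides are conjugate-linear in `q`, and on a character the identity is exactly `hfp`. The
multiplier appears conjugated there because the average sits in the conjugated slot. -/
theorem integral_mul_conj_kernelAverage {κ : ℝ → ℂ} (hκ : Integrable κ) {f p : G → ℂ}
    (hf : Integrable f (normalizedHaar G)) (hp : Integrable p (normalizedHaar G))
    (hfp : ∀ (χ : PontryaginDual G) (x : ℝ), HasFrequency β χ x →
      conj (∫ w, κ w * Complex.exp ((2 * Real.pi * w * x : ℝ) * Complex.I)) *
        groupFourierCoeff f χ = groupFourierCoeff p χ)
    {q : G → ℂ} (hq : q ∈ trigPolynomials β) :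
    Continuous q ∧ Continuous (kernelAverage β κ q) ∧
      ∫ ω, f ω * conj (kernelAverage β κ q ω) ∂(normalizedHaar G) =
        ∫ ω, p ω * conj (q ω) ∂(normalizedHaar G) := by
  have hmul {g h : G → ℂ} (hg : Integrable g (normalizedHaar G)) (hh : Continuous h) :
      Integrable (fun ω => g ω * conj (h ω)) (normalizedHaar G) := by
    have hh' : Continuous fun ω => conj (h ω) := Complex.continuous_conj.comp hh
    obtain ⟨c, hc⟩ := isCompact_univ.exists_bound_of_continuousOn hh'.continuousOn
    exact hg.mul_bdd (c := c) hh'.aestronglyMeasurable (ae_of_all _ fun w => hc _ (Set.mem_univ _))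
  rw [mem_trigPolynomials_iff] at hq
  induction hq using Submodule.span_induction with
  | mem g hg =>
    obtain ⟨χ, x, hχ, rfl⟩ := hg
    have hk := funext (kernelAverage_character hχ κ)
    refine ⟨continuous_character χ, ?_, ?_⟩
    · rw [hk]
      exact continuous_const.mul (continuous_character χ)
    · refine Eq.trans ?_ (hfp χ x hχ)
      rw [hk, groupFourierCoeff, ← integral_const_mul]
      congr 1 with ω
      rw [map_mul]
      ring
  | zero =>
    have : kernelAverage β κ 0 = 0 := by ext; simp [kernelAverage]
    rw [this]
    exact ⟨continuous_zero, continuous_zero, by simp⟩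
  | add g h _ _ ihg ihh =>
    obtain ⟨g1, g2, g3⟩ := ihg
    obtain ⟨h1, h2, h3⟩ := ihh
    have hk : kernelAverage β κ (g + h) = kernelAverage β κ g + kernelAverage β κ h := by
      ext ω
      simp only [kernelAverage, Pi.add_apply, mul_add]
      exact integral_add (integrable_kernel_mul hκ g1 ω) (integrable_kernel_mul hκ h1 ω)
    rw [hk]
    refine ⟨g1.add h1, g2.add h2, ?_⟩
    simp only [Pi.add_apply, map_add, mul_add]
    rw [integral_add (hmul hf g2) (hmul hf h2), integral_add (hmul hp g1) (hmul hp h1), g3, h3]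
  | smul z g _ ih =>
    obtain ⟨g1, g2, g3⟩ := ih
    have hk : kernelAverage β κ (z • g) = z • kernelAverage β κ g := by
      ext ω
      simp only [kernelAverage, Pi.smul_apply, smul_eq_mul, mul_left_comm _ z]
      exact integral_const_mul z _
    rw [hk]
    refine ⟨g1.const_smul z, g2.const_smul z, ?_⟩
    simp only [Pi.smul_apply, smul_eq_mul, map_mul, mul_left_comm _ (conj z)]
    rw [integral_const_mul, integral_const_mul, g3]

/-- Otherwise `‖p‖ > c > B` on a nonempty open set `U`, which has positive Haar measure. In `∫ ‖p‖ ^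
(2m+1) * (‖p‖ - B) ≤ 0` the set `U` contributes at least `c ^ (2m+1) * (c - B) * μ(U)`, while the
rest loses at most `B ^ (2m+2)`; as `c > B`, this fails for large `m`. -/
theorem norm_le_of_integral_norm_pow_le {p : G → ℂ} (hp : Continuous p) {B : ℝ} (hB : 0 ≤ B)
    (h : ∀ m : ℕ, ∫ ω, ‖p ω‖ ^ (2 * m + 2) ∂(normalizedHaar G) ≤
      B * ∫ ω, ‖p ω‖ ^ (2 * m + 1) ∂(normalizedHaar G)) (ω : G) : ‖p ω‖ ≤ B := by
  by_contra! hlt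
  obtain ⟨c, hBc, hc⟩ := exists_between hlt
  have hc0 : 0 < c := hB.trans_lt hBc
  set U : Set G := {η | c < ‖p η‖} with hU
  have hUo : IsOpen U := isOpen_lt continuous_const hp.norm
  have hUpos : 0 < (normalizedHaar G).real U :=
    ENNReal.toReal_pos (hUo.measure_pos _ ⟨ω, hc⟩).ne' (measure_ne_top _ _)
  have key (m : ℕ) : c ^ (2 * m + 1) * ((c - B) * (normalizedHaar G).real U) ≤
      B ^ (2 * m + 1) * B := by
    have hpt (η : G) : U.indicator (fun _ => c ^ (2 * m + 1) * (c - B)) η - B ^ (2 * m + 1) * B ≤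
        ‖p η‖ ^ (2 * m + 2) - B * ‖p η‖ ^ (2 * m + 1) := by
      have e : ‖p η‖ ^ (2 * m + 2) - B * ‖p η‖ ^ (2 * m + 1) =
        ‖p η‖ ^ (2 * m + 1) * (‖p η‖ - B) := by ring
      have hBB : 0 ≤ B ^ (2 * m + 1) * B := by positivity
      rw [e]
      by_cases hη : η ∈ U
      · rw [Set.indicator_of_mem hη]
        have hη' : c < ‖p η‖ := hη
        have : c ^ (2 * m + 1) * (c - B) ≤ ‖p η‖ ^ (2 * m + 1) * (‖p η‖ - B) := by
          have : 0 ≤ c - B := by linarith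
          gcongr
        linarith
      · rw [Set.indicator_of_notMem hη]
        rcases le_total B ‖p η‖ with h1 | h1
        · have : 0 ≤ ‖p η‖ ^ (2 * m + 1) * (‖p η‖ - B) :=
            mul_nonneg (by positivity) (by linarith)
          linarith
        · have h2 : ‖p η‖ ^ (2 * m + 1) * (B - ‖p η‖) ≤ B ^ (2 * m + 1) * B := by
            have := norm_nonneg (p η)
            have : 0 ≤ B - ‖p η‖ := by linarith
            gcongr
            linarith
          linarith
    have i1 : Integrable (fun η => ‖p η‖ ^ (2 * m + 2)) (normalizedHaar G) :=
      integrable_of_continuous (hp.norm.pow _)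
    have i2 : Integrable (fun η => B * ‖p η‖ ^ (2 * m + 1)) (normalizedHaar G) :=
      integrable_of_continuous (continuous_const.mul (hp.norm.pow _))
    have i3 : Integrable (U.indicator fun _ => c ^ (2 * m + 1) * (c - B)) (normalizedHaar G) :=
      (integrable_const _).indicator hUo.measurableSet
    have := integral_mono (i3.sub (integrable_const (B ^ (2 * m + 1) * B))) (i1.sub i2) hpt
    simp only [Pi.sub_apply] at this
    rw [integral_sub i3 (integrable_const _), integral_sub i1 i2,
      integral_indicator hUo.measurableSet] at this
    simp only [integral_const_mul, integral_const, MeasurableSet.univ, measureReal_restrict_apply, Set.univ_inter,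
      smul_eq_mul, probReal_univ, one_mul] at this
    linarith [h m]
  have hcB : 0 < (c - B) * (normalizedHaar G).real U := mul_pos (by linarith) hUpos
  rcases hB.eq_or_lt with rfl | hB0
  -- For `B = 0` the ratio `c / B` is unusable, but `m = 0` already gives a contradiction.
  · have := key 0
    simp only [mul_zero] at this
    exact absurd this (not_le.mpr (by positivity))
  · have hr : 1 < c / B := (one_lt_div hB0).mpr hBc
    obtain ⟨m, hm⟩ := pow_unbounded_of_one_lt (B / ((c - B) * (normalizedHaar G).real U)) hr
    have h1 := hm.trans_le (pow_le_pow_right₀ hr.le (show m ≤ 2 * m + 1 by omega))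
    rw [div_lt_iff₀ hcB, div_pow, div_mul_eq_mul_div, lt_div_iff₀ (by positivity)] at h1
    linarith [key m]

end

/-! ### Partial sums on the group -/

section

variable {G : Type*} [CommGroup G] [TopologicalSpace G] [IsTopologicalGroup G] [CompactSpace G]
  [MeasurableSpace G] [BorelSpace G] {β : Multiplicative ℝ →ₜ* G}

/-- The sum `p` has the Fourier coefficients of `f` multiplied by the inverse transform of `κ`;
duality against powers of `p` itself then bounds its supremum. -/
theorem norm_sum_characters_le {lam : ℕ → ℝ} (hlam : IsFrequency lam) (hβ : DenseRange β)
    {a : ℕ → ℂ} {f : Lp ℂ ∞ (normalizedHaar G)} (hf : f ∈ groupHardySpace lam β ∞)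
    (hfa : IsBohrTransform lam β f a) {χ : ℕ → PontryaginDual G}
    (hχ : ∀ n, HasFrequency β (χ n) (lam n)) {N : ℕ} {κ : ℝ → ℂ} (hκ : Integrable κ)
    (hκ1 : ∀ x : ℝ, |x| ≤ lam N →
      ∫ w, κ w * Complex.exp ((2 * Real.pi * w * x : ℝ) * Complex.I) = 1)
    (hκ0 : ∀ x : ℝ, lam (N + 1) ≤ |x| →
      ∫ w, κ w * Complex.exp ((2 * Real.pi * w * x : ℝ) * Complex.I) = 0) (ω : G) :
    ‖∑ n ∈ Finset.range (N + 1), a n * (χ n ω : ℂ)‖ ≤ (∫ w, ‖κ w‖) * ‖f‖ := by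
  classical
  set p : G → ℂ := fun ω => ∑ n ∈ Finset.range (N + 1), a n * (χ n ω : ℂ) with hp
  have hpc : Continuous p := continuous_finsetSum _ fun n _ =>
    continuous_const.mul (continuous_character (χ n))
  have ha (n : ℕ) : a n = groupFourierCoeff f (χ n) := by
    obtain ⟨ψ, hψ, h⟩ := hfa n
    rw [h, hψ.eq_of_denseRange hβ (hχ n)]
  have hfint : Integrable f (normalizedHaar G) := (Lp.memLp f).integrable le_top
  have hcoeff (ψ : PontryaginDual G) (x : ℝ) (hψ : HasFrequency β ψ x) :
      conj (∫ w, κ w * Complex.exp ((2 * Real.pi * w * x : ℝ) * Complex.I)) *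
        groupFourierCoeff f ψ = groupFourierCoeff p ψ := by
    rw [hp, groupFourierCoeff_sum_characters]
    -- At `lam n` the multiplier is `1` for `n ≤ N` and `0` for `n ≥ N + 1`; at every other
    -- character `f` itself has coefficient zero.
    by_cases hx : ∃ n, HasFrequency β ψ (lam n)
    · obtain ⟨n, hn⟩ := hx
      obtain rfl := hn.eq_of_denseRange hβ (hχ n)
      obtain rfl := hψ.frequency_unique hn
      have hinj (m : ℕ) : χ m = χ n ↔ m = n :=
        ⟨fun h => hlam.strictMono.injective ((h ▸ hχ m).frequency_unique hn), fun h => h ▸ rfl⟩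
      simp only [hinj, Finset.sum_ite_eq', Finset.mem_range, ← ha]
      split_ifs with h
      · rw [hκ1 _ ?_, map_one, one_mul]
        rw [abs_of_nonneg (hlam.nonneg n)]
        exact hlam.strictMono.monotone (by omega)
      · rw [hκ0 _ ?_, map_zero, zero_mul]
        rw [abs_of_nonneg (hlam.nonneg n)]
        exact hlam.strictMono.monotone (by omega)
    · push Not at hx
      rw [hf ψ hx, mul_zero]
      exact (Finset.sum_eq_zero fun n _ => if_neg fun h : χ n = ψ => hx n (h ▸ hχ n)).symm
  have hpT : p ∈ trigPolynomials β := by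
    have : p = ∑ n ∈ Finset.range (N + 1), a n • fun ω => (χ n ω : ℂ) := by
      ext ω
      simp [hp]
    rw [this]
    exact Subalgebra.sum_mem _ fun n _ => Subalgebra.smul_mem _ (hχ n).mem_trigPolynomials _
  -- Conjugation inverts characters and so brings in the frequencies `-lam n`; hence
  -- `trigPolynomials` admits all real frequencies.
  have hpT' : (fun ω => conj (p ω)) ∈ trigPolynomials β := by
    have : (fun ω => conj (p ω)) =
        ∑ n ∈ Finset.range (N + 1), conj (a n) • fun ω => (((χ n)⁻¹ : PontryaginDual G) ω : ℂ) := by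
      ext ω
      have (n : ℕ) : (χ n)⁻¹ ω = (χ n ω)⁻¹ := rfl
      simp [hp, this, ← Circle.coe_inv_eq_conj]
    rw [this]
    exact Subalgebra.sum_mem _ fun n _ => Subalgebra.smul_mem _ (hχ n).inv.mem_trigPolynomials _
  have hfbd : ∀ᵐ ω ∂(normalizedHaar G), ‖f ω‖ ≤ ‖f‖ := by
    rw [Lp.norm_def]
    have hfin : eLpNorm f ∞ (normalizedHaar G) ≠ ∞ := Lp.eLpNorm_ne_top f
    rw [eLpNorm_exponent_top] at hfin ⊢
    filter_upwards [ae_le_eLpNormEssSup (f := f) (μ := normalizedHaar G)] with ω hω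
    simpa using ENNReal.toReal_mono hfin hω
  refine norm_le_of_integral_norm_pow_le hpc
    (mul_nonneg (integral_nonneg fun _ => norm_nonneg _) (norm_nonneg f)) (fun m => ?_) ω
  -- The test function is `p * |p| ^ (2m)`; the even power of the modulus keeps it a trigonometric
  -- polynomial.
  have hq : p * (p * fun ω => conj (p ω)) ^ m ∈ trigPolynomials β :=
    Subalgebra.mul_mem _ hpT (Subalgebra.pow_mem _ (Subalgebra.mul_mem _ hpT hpT') m)
  set q : G → ℂ := p * (p * fun ω => conj (p ω)) ^ m with hqdef
  have hqn (ω : G) : ‖q ω‖ = ‖p ω‖ ^ (2 * m + 1) := by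
    simp only [hqdef, Pi.mul_apply, Pi.pow_apply, norm_mul, norm_pow, RCLike.norm_conj]
    ring
  have hpq (ω : G) : p ω * conj (q ω) = ((‖p ω‖ ^ (2 * m + 2) : ℝ) : ℂ) := by
    simp only [hqdef, Pi.mul_apply, Pi.pow_apply, map_mul, map_pow, Complex.conj_conj]
    rw [mul_comm (conj (p ω)) (p ω), ← mul_assoc, Complex.mul_conj']
    push_cast
    ring
  obtain ⟨hqc, hkc, hq3⟩ := integral_mul_conj_kernelAverage hκ hfint
    (integrable_of_continuous hpc) hcoeff hq
  simp only [hpq] at hq3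
  rw [integral_complex_ofReal] at hq3
  have hnn : 0 ≤ ∫ ω, ‖p ω‖ ^ (2 * m + 2) ∂(normalizedHaar G) :=
    integral_nonneg fun _ => by positivity
  calc ∫ ω, ‖p ω‖ ^ (2 * m + 2) ∂(normalizedHaar G)
      = ‖∫ ω, f ω * conj (kernelAverage β κ q ω) ∂(normalizedHaar G)‖ := by
        rw [hq3, Complex.norm_real, Real.norm_of_nonneg hnn]
    _ ≤ ∫ ω, ‖f‖ * ‖kernelAverage β κ q ω‖ ∂(normalizedHaar G) := by
        refine norm_integral_le_of_norm_le
          (integrable_of_continuous (continuous_const.mul hkc.norm)) ?_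
        filter_upwards [hfbd] with ω hω
        rw [norm_mul, RCLike.norm_conj]
        gcongr
    _ ≤ ‖f‖ * ((∫ w, ‖κ w‖) * ∫ ω, ‖q ω‖ ∂(normalizedHaar G)) := by
        rw [integral_const_mul]
        gcongr
        exact integral_norm_kernelAverage_le hκ hqc
    _ = (∫ w, ‖κ w‖) * ‖f‖ * ∫ ω, ‖p ω‖ ^ (2 * m + 1) ∂(normalizedHaar G) := by
        simp only [hqn]
        ring

/-- A bound for a trigonometric polynomial `∑ a n h_{lam n}`, `n ≤ N`, on the group puts the partial
sum into `𝓗_∞(lam)` with the same bound for its norm. -/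
theorem dirichletPartialSum_mem_and_norm_le {lam : ℕ → ℝ} (hlam : IsFrequency lam) (a : ℕ → ℂ)
    {χ : ℕ → PontryaginDual G} (hχ : ∀ n, HasFrequency β (χ n) (lam n)) {N : ℕ} {B : ℝ}
    (hB : ∀ ω, ‖∑ n ∈ Finset.range (N + 1), a n * (χ n ω : ℂ)‖ ≤ B) :
    dirichletPartialSum a N ∈ dirichletHardySpace lam β ∞ ∧
      dirichletHardyNorm lam β ∞ (dirichletPartialSum a N) ≤ B := by
  classical
  have hpc : Continuous fun ω => ∑ n ∈ Finset.range (N + 1), a n * (χ n ω : ℂ) :=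
    continuous_finsetSum _ fun n _ => continuous_const.mul (continuous_character (χ n))
  have hmem : MemLp (fun ω => ∑ n ∈ Finset.range (N + 1), a n * (χ n ω : ℂ)) ∞
      (normalizedHaar G) :=
    memLp_top_of_bound hpc.aestronglyMeasurable B (ae_of_all _ hB)
  have hcoeff (ψ : PontryaginDual G) : groupFourierCoeff (hmem.toLp _) ψ =
      ∑ n ∈ Finset.range (N + 1), if χ n = ψ then a n else 0 := by
    rw [← groupFourierCoeff_sum_characters]
    refine integral_congr_ae ?_
    filter_upwards [hmem.coeFn_toLp] with ω hω
    rw [hω]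
  have hH : hmem.toLp _ ∈ groupHardySpace lam β ∞ := fun ψ hψ => by
    rw [hcoeff]
    exact Finset.sum_eq_zero fun n _ => if_neg fun h : χ n = ψ => hψ n (h ▸ hχ n)
  have hT : IsBohrTransform lam β (hmem.toLp _) (dirichletPartialSum a N) := fun n => by
    refine ⟨χ n, hχ n, ?_⟩
    have hinj (m : ℕ) : χ m = χ n ↔ m = n :=
      ⟨fun h => hlam.strictMono.injective ((h ▸ hχ m).frequency_unique (hχ n)), fun h => h ▸ rfl⟩
    simp only [hcoeff, hinj, Finset.sum_ite_eq', Finset.mem_range, Nat.lt_succ_iff,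
      dirichletPartialSum]
  refine ⟨⟨_, hH, hT⟩, ?_⟩
  have hle : dirichletHardyNorm lam β ∞ (dirichletPartialSum a N) ≤ ‖hmem.toLp _‖ := by
    refine csInf_le ⟨0, ?_⟩ ⟨_, hH, hT, rfl⟩
    rintro r ⟨f, -, -, rfl⟩
    exact norm_nonneg f
  refine hle.trans ((Lp.norm_le_of_ae_bound ((norm_nonneg _).trans (hB 1)) (C := B) ?_).trans ?_)
  · filter_upwards [hmem.coeFn_toLp] with ω hω
    rw [hω]
    exact hB ω
  · simp

end

/-! ### The half-plane bound and the main theorem -/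

/-- A Dirichlet polynomial is bounded on the right half-plane by its bound on the imaginary axis. -/
theorem norm_dirichletPolynomial_le {lam : ℕ → ℝ} (hlam : ∀ n, 0 ≤ lam n) (a : ℕ → ℂ)
    (s : Finset ℕ) {B : ℝ}
    (hB : ∀ t : ℝ, ‖∑ n ∈ s, a n * Complex.exp (-(lam n * (t * Complex.I)))‖ ≤ B)
    {z : ℂ} (hz : 0 ≤ z.re) : ‖∑ n ∈ s, a n * Complex.exp (-(lam n * z))‖ ≤ B := by
  have hbd (z : ℂ) (hz : 0 ≤ z.re) :
      ‖∑ n ∈ s, a n * Complex.exp (-(lam n * z))‖ ≤ ∑ n ∈ s, ‖a n‖ := by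
    refine norm_sum_le_of_le _ fun n _ => ?_
    rw [norm_mul, Complex.norm_exp]
    refine mul_le_of_le_one_right (norm_nonneg _) (Real.exp_le_one_iff.mpr ?_)
    simpa using mul_nonneg (hlam n) hz
  have hd : Differentiable ℂ fun z : ℂ => ∑ n ∈ s, a n * Complex.exp (-(lam n * z)) := by
    fun_prop
  -- The crude bound `∑ ‖a n‖` on the closed half-plane supplies both the growth condition and
  -- boundedness on the positive real axis.
  refine PhragmenLindelof.right_half_plane_of_bounded_on_real
    (f := fun z => ∑ n ∈ s, a n * Complex.exp (-(lam n * z))) hd.diffContOnCl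
    ⟨1, one_lt_two, 0, ?_⟩ ?_ hB hz
  · refine Asymptotics.IsBigO.of_bound (∑ n ∈ s, ‖a n‖) ?_
    refine eventually_inf_principal.mpr (Eventually.of_forall fun z hz => ?_)
    simpa using hbd z (le_of_lt hz)
  · refine ⟨∑ n ∈ s, ‖a n‖, ?_⟩
    rw [eventually_map]
    filter_upwards [eventually_ge_atTop 0] with x hx
    exact hbd x (by simpa using hx)

theorem mainTheorem8 :
    ∃ C : ℝ, 0 < C ∧
      ∀ (lam : ℕ → ℝ), IsFrequency lam →
      ∀ (G : Type*) [CommGroup G] [TopologicalSpace G] [IsTopologicalGroup G]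
        [CompactSpace G] [T2Space G] [MeasurableSpace G] [BorelSpace G]
        (β : Multiplicative ℝ →ₜ* G), IsLambdaDirichletGroup lam β →
      ∀ a ∈ dirichletHardySpace lam β ∞, ∀ k : ℝ, 0 < k → k ≤ 1 → ∀ N : ℕ,
        dirichletPartialSum a N ∈ dirichletHardySpace lam β ∞ ∧
        dirichletHardyNorm lam β ∞ (dirichletPartialSum a N) ≤
          C / k * (lam (N + 1) / (lam (N + 1) - lam N)) ^ k * dirichletHardyNorm lam β ∞ a ∧
        ∀ s : ℂ, 0 < s.re →
          ‖∑ n ∈ Finset.range (N + 1), a n * Complex.exp (-(lam n * s))‖ ≤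
            C / k * (lam (N + 1) / (lam (N + 1) - lam N)) ^ k * dirichletHardyNorm lam β ∞ a := by
  refine ⟨8, by norm_num, ?_⟩
  intro lam hlam G _ _ _ _ _ _ _ β hβ a ha k hk hk1 N
  choose χ hχ using hβ.exists_character
  have hlt : lam N < lam (N + 1) := hlam.strictMono N.lt_succ_self
  -- The value `lam N = 0` is allowed; the trapezoid is then a tent.
  obtain ⟨κ, hκ, hκn, hκ1, hκ0⟩ := exists_kernel (hlam.nonneg N) hlt
  set A : ℝ := 8 / k * (lam (N + 1) / (lam (N + 1) - lam N)) ^ k with hA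
  have hA0 : 0 < A := by
    have h1 : 0 < lam (N + 1) - lam N := sub_pos.mpr hlt
    have h2 : 0 < lam (N + 1) := (hlam.nonneg N).trans_lt hlt
    positivity
  have hB (ω : G) : ‖∑ n ∈ Finset.range (N + 1), a n * (χ n ω : ℂ)‖ ≤
      A * dirichletHardyNorm lam β ∞ a := by
    -- The norm is an infimum over all representing `f`. The estimate holds for each of them, so it
    -- passes to the infimum without using uniqueness of `f`.
    rw [← div_le_iff₀' hA0]
    obtain ⟨f₀, hf₀, hfa₀⟩ := ha
    refine le_csInf ⟨_, f₀, hf₀, hfa₀, rfl⟩ ?_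
    rintro r ⟨f, hf, hfa, rfl⟩
    rw [div_le_iff₀' hA0]
    refine (norm_sum_characters_le hlam hβ.denseRange hf hfa hχ hκ hκ1 hκ0 ω).trans ?_
    exact mul_le_mul_of_nonneg_right (hκn k hk hk1) (norm_nonneg f)
  obtain ⟨h1, h2⟩ := dirichletPartialSum_mem_and_norm_le hlam a hχ hB
  refine ⟨h1, h2, fun s hs => norm_dirichletPolynomial_le hlam.nonneg a _ (fun t => ?_) hs.le⟩
  -- At the point `β t` the character `χ n` takes the value `e^{-i lam n t}`, so the bound on `G`
  -- contains the bound on the imaginary axis.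
  convert hB (β (Multiplicative.ofAdd t)) using 4 with n
  rw [hχ n t]
  congr 1
  ring
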